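/- Let $M\ge 1$ be the number of antennas and, for phases $\psi=(\psi_0,\dots,\psi_{M-1})\in[0,2\pi]^M$ with $\psi_0=0$ (call these admissible), put $\Phi_t=-t\pi\sin\phi$ and $$f(\psi,\phi)=\Big(1+\sum_{t=1}^{M-1}\cos(\psi_t+\Phi_t)\Big)^2+\Big(\sum_{t=1}^{M-1}\sin(\psi_t+\Phi_t)\Big)^2,\qquad f(\psi)=\frac1{2\pi}\int_0^{2\pi}f(\psi,\phi)\,d\phi .$$ Let $J_0(x)=\sum_{k\ge0}(-1)^k(x^2/4)^k/(k!)^2$ be the Bessel function of the first kind of order $0$. Then: 1. $f(\psi)=M+2\sum_{t=1}^{M-1}J_0(t\pi)\cos\psi_t+2\sum_{t=1}^{M-2}\sum_{l=t+1}^{M-1}J_0((t-l)\pi)\cos(\psi_t-\psi_l)$. 2. $f(\psi)\le M+2\sum_{t=1}^{M-1}|J_0(t\pi)|+2\sum_{t=1}^{M-2}\sum_{l=t+1}^{M-1}|J_0((t-l)\pi)|$ (both 1 and 2 hold for arbitrary real $\psi_t$), and equality holds for the admissible phases $\psi_t=\mathrm{mod}(t,2)\,\pi$, which therefore maximize $f$.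 3. An admissible $\psi$ maximizes $f$ over the admissible phases if and only if consecutive antennas are $\pi$ phase-shifted, that is, $\psi_{t+1}-\psi_t\equiv\pi \pmod{2\pi}$ for $0\le t\le M-2$. 4. Let $\beta>0$, $\kappa\ge0$, $\varphi_0\in\mathbb R$, let $R$ be a real symmetric positive semidefinite $M\times M$ matrix, let $\phi$ be uniform on $[0,2\pi]$ and let $z\sim\mathcal{CN}(0,R)$ be independent of $\phi$. Consider the equivalent channel vector $h^*_t=\sqrt{\tfrac{\kappa}{1+\kappa}}\,e^{i\varphi_0}e^{i(\Phi_t+\psi_t)}+\sqrt{\tfrac1{1+\kappa}}\,z_t$, $0\le t\le M-1$. If all antennas send the same signal (AA-SS), the incident RF energy is $\xi=\frac{\beta}{M}\big|\sum_t h^*_t\big|^2$. For every admissible $\psi$ it is integrable, with $$\mathbb E[\xi]=\frac{\beta}{M(\kappa+1)}\Big(\sum_{i,j}R_{ij}+\kappa f(\psi)\Big).$$ Hence $\psi_t=\mathrm{mod}(t,2)\,\pi$ maximizes $\mathbb E[\xi]$ over the admissible phases; and if $\kappa>0$, an admissible $\psi$ maximizes $\mathbb E[\xi]$ if and only if consecutive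 antennas are $\pi$ phase-shifted modulo $2\pi$. If $R$ is diagonal, $\mathbb E[\xi]$ is also the average incident RF energy of the phase-adjusted channel $\Psi h$, where $\Psi=\mathrm{diag}(e^{i\psi_0},\dots,e^{i\psi_{M-1}})$ and $h_t=\sqrt{\tfrac{\kappa}{1+\kappa}}\,e^{i\varphi_0}e^{i\Phi_t}+\sqrt{\tfrac1{1+\kappa}}\,z_t$. -/

import Mathlib

open MeasureTheory ProbabilityTheory

noncomputable section

namespace AASS

/-- Bessel function of the first kind of order `0`, by its power series. -/
def J0 (x : ℝ) : ℝ :=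
  ∑' k : ℕ, (-1 : ℝ) ^ k * (x ^ 2 / 4) ^ k / ((k.factorial : ℝ) ^ 2)

/-- Mean phase shift of the `t`-th element (counted from `0`) of a half-wavelength uniform linear
array, for azimuth `φ`. -/
def Phi (t : ℕ) (φ : ℝ) : ℝ := -(t : ℝ) * Real.pi * Real.sin φ

def upsilon1 (M : ℕ) (ψ : ℕ → ℝ) (φ : ℝ) : ℝ :=
  1 + ∑ t ∈ Finset.Icc 1 (M - 1), Real.cos (ψ t + Phi t φ)

def upsilon2 (M : ℕ) (ψ : ℕ → ℝ) (φ : ℝ) : ℝ :=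
  ∑ t ∈ Finset.Icc 1 (M - 1), Real.sin (ψ t + Phi t φ)

/-- `f(ψ, φ)`. -/
def fAt (M : ℕ) (ψ : ℕ → ℝ) (φ : ℝ) : ℝ := upsilon1 M ψ φ ^ 2 + upsilon2 M ψ φ ^ 2

/-- `f(ψ)`: the average of `f(ψ, φ)` over an azimuth `φ` uniform in `[0, 2π]`. -/
def fAvg (M : ℕ) (ψ : ℕ → ℝ) : ℝ :=
  1 / (2 * Real.pi) * ∫ φ in (0 : ℝ)..(2 * Real.pi), fAt M ψ φ

/-- The upper bound on `f(ψ)`, with `|J₀|` in place of `J₀` and every cosine replaced by `1`. -/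
def fUpper (M : ℕ) : ℝ :=
  (M : ℝ) + 2 * ∑ t ∈ Finset.Icc 1 (M - 1), |J0 ((t : ℝ) * Real.pi)|
    + 2 * ∑ t ∈ Finset.Icc 1 (M - 2), ∑ l ∈ Finset.Icc (t + 1) (M - 1),
        |J0 (((t : ℝ) - (l : ℝ)) * Real.pi)|

/-- The admissible phase vectors `(ψ₀, …, ψ_{M-1})`: `ψ₀ = 0` and all entries in `[0, 2π]`.
Entries with index at least `M` play no role. -/
def admissible (M : ℕ) : Set (ℕ → ℝ) :=
  {ψ | ψ 0 = 0 ∧ ∀ t < M, ψ t ∈ Set.Icc 0 (2 * Real.pi)}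

/-- The phase vector `ψ_t = mod(t, 2) π`. -/
def psiOpt (t : ℕ) : ℝ := ((t % 2 : ℕ) : ℝ) * Real.pi

/-- Consecutive antennas are phase-shifted by `π`, modulo `2π`. -/
def ConsecutivePiShifted (M : ℕ) (ψ : ℕ → ℝ) : Prop :=
  ∀ t : ℕ, t + 1 < M → ∃ k : ℤ, ψ (t + 1) - ψ t = Real.pi + 2 * Real.pi * (k : ℝ)

/-- The circularly-symmetric complex Gaussian law `CN(0, R)` with real covariance matrix `R`: real
and imaginary parts are independent, each with law `N(0, R / 2)`. -/
def complexGaussian {M : ℕ} (R : Matrix (Fin M) (Fin M) ℝ) : Measure (Fin M → ℂ) :=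
  ((multivariateGaussian 0 ((1 / 2 : ℝ) • R)).prod
    (multivariateGaussian 0 ((1 / 2 : ℝ) • R))).map
      (fun p j => (⟨p.1 j, p.2 j⟩ : ℂ))

/-- The joint law of the azimuth `φ`, uniform in `[0, 2π]`, and of an independent scattering
component with law `CN(0, R)`. -/
def jointLaw {M : ℕ} (R : Matrix (Fin M) (Fin M) ℝ) : Measure (ℝ × (Fin M → ℂ)) :=
  (cond (volume : Measure ℝ) (Set.Icc 0 (2 * Real.pi))).prod (complexGaussian R)

/-- The normalized Rician channel vector `h`, before any phase adjustment, with Rician factor `κ`,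
initial phase `φ₀`, azimuth `φ` and scattering component `z`. -/
def channel {M : ℕ} (κ φ₀ φ : ℝ) (z : Fin M → ℂ) : Fin M → ℂ := fun j =>
  (Real.sqrt (κ / (1 + κ)) : ℂ) * Complex.exp (Complex.I * (φ₀ : ℂ))
      * Complex.exp (Complex.I * (Phi (j : ℕ) φ : ℂ))
    + (Real.sqrt (1 / (1 + κ)) : ℂ) * z j

/-- The equivalent normalized channel vector `h*` under the phase adjustment `ψ`: the phases `ψ_t`
are added to the line-of-sight component and the scattering component has law `CN(0, R)`. -/
def equivChannel {M : ℕ} (κ φ₀ : ℝ) (ψ : ℕ → ℝ) (φ : ℝ) (z : Fin M → ℂ) : Fin M → ℂ := fun j =>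
  (Real.sqrt (κ / (1 + κ)) : ℂ) * Complex.exp (Complex.I * (φ₀ : ℂ))
      * Complex.exp (Complex.I * ((Phi (j : ℕ) φ + ψ (j : ℕ) : ℝ) : ℂ))
    + (Real.sqrt (1 / (1 + κ)) : ℂ) * z j

/-- The diagonal matrix `Ψ` of the phase adjustment, applied to a channel vector. -/
def applyPsi {M : ℕ} (ψ : ℕ → ℝ) (h : Fin M → ℂ) : Fin M → ℂ := fun j =>
  Complex.exp (Complex.I * (ψ (j : ℕ) : ℂ)) * h j

/-- Incident RF energy when all antennas transmit the same signal over the channel `h`. -/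
def rfEnergy {M : ℕ} (β : ℝ) (h : Fin M → ℂ) : ℝ := β / (M : ℝ) * ‖∑ j, h j‖ ^ 2

/-- Average incident RF energy, over azimuth and fading, for the equivalent channel. -/
def avgRFEnergy {M : ℕ} (β κ φ₀ : ℝ) (R : Matrix (Fin M) (Fin M) ℝ) (ψ : ℕ → ℝ) : ℝ :=
  ∫ p, rfEnergy β (equivChannel κ φ₀ ψ p.1 p.2) ∂(jointLaw R)

end AASS

end

noncomputable section

/-! ### Integral representations of `J0` and its signs at the multiples of `π`. -/

namespace AASS

open Real

/-! Expanding the squared modulus of a sum of unit phasors leaves cosines of phase differences.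
Averaging over the azimuth turns each cosine into a value of `J0` times the cosine of a difference
of the `ψ t`, which gives the closed form and, termwise, the upper bound.

The bound is attained because `J0 (n * π)` has the strict sign `(-1) ^ n` for `n ≥ 1`
(`neg_one_pow_mul_J0_pos`). Alternating phases then match every sign simultaneously. The deficit
`fUpper - fAvg` is a sum of nonnegative terms (`fUpper_sub_fAvg`), and since no `J0 (t * π)`
vanishes, its terms against antenna `0` alone force `cos (ψ t) = (-1) ^ t`, that is, shifts by `π`
modulo `2 * π`.

For the sign, `(-1) ^ n * J0 (n * π)` is a positive multiple of the integral of `cos (n * π * (1 -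
cos θ))` over a quarter period. Two integrations by parts with vanishing boundary terms replace the
integrand by a nonnegative one that is positive near `0`.

For the energy, the scattering has mean zero and is independent of the azimuth, so the cross term
averages out. What remains is increasing and affine in `fAvg`, strictly so when `κ > 0`, so the
maximizers carry over. -/

lemma prod_odd_div_even (n : ℕ) :
    ∏ i ∈ Finset.range n, (2 * (i : ℝ) + 1) / (2 * i + 2) =
      ((2 * n).factorial : ℝ) / (4 ^ n * (n.factorial : ℝ) ^ 2) := by
  induction n with
  | zero => simp
  | succ k ih =>
    have h : 2 * (k + 1) = 2 * k + 1 + 1 := by ring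
    rw [Finset.prod_range_succ, ih, h, Nat.factorial_succ, Nat.factorial_succ,
      Nat.factorial_succ]
    have hk := Nat.factorial_ne_zero k
    push_cast
    field_simp
    ring

/-- Parseval's integral for the Bessel function `J₀`. -/
lemma integral_cos_mul_sin_eq (x : ℝ) : ∫ φ in (0 : ℝ)..π, cos (x * sin φ) = π * J0 x := by
  have key : HasSum
      (fun n : ℕ => ∫ φ in (0 : ℝ)..π,
        (-1 : ℝ) ^ n * (x * sin φ) ^ (2 * n) / ((2 * n).factorial : ℝ))
      (∫ φ in (0 : ℝ)..π, cos (x * sin φ)) := by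
    refine intervalIntegral.hasSum_integral_of_dominated_convergence
      (fun n _ => |x| ^ (2 * n) / ((2 * n).factorial : ℝ)) ?_ ?_ ?_ ?_ ?_
    · intro n
      exact Continuous.aestronglyMeasurable (by fun_prop)
    · intro n
      refine Filter.Eventually.of_forall fun φ _ => ?_
      rw [norm_div, norm_mul, norm_pow, norm_pow, norm_mul, mul_pow]
      simp only [norm_neg, norm_one, one_pow, one_mul, Real.norm_eq_abs, Nat.abs_cast]
      gcongr
      exact mul_le_of_le_one_right (by positivity)
        (pow_le_one₀ (abs_nonneg _) (abs_sin_le_one φ))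
    · refine Filter.Eventually.of_forall fun φ _ => ?_
      -- The dominating constants are the terms of the series of `cosh |x|`.
      exact (Real.hasSum_cosh |x|).summable
    · exact intervalIntegrable_const
    · exact Filter.Eventually.of_forall fun φ _ => Real.hasSum_cos (x * sin φ)
  rw [← key.tsum_eq, J0, ← tsum_mul_left]
  congr 1
  ext n
  have h : ∀ φ : ℝ, (-1 : ℝ) ^ n * (x * sin φ) ^ (2 * n) / ((2 * n).factorial : ℝ) =
      ((-1 : ℝ) ^ n * x ^ (2 * n) / ((2 * n).factorial : ℝ)) * sin φ ^ (2 * n) := by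
    intro φ; ring
  simp_rw [h]
  -- The factor `(2 * n)!` of the Wallis product cancels the one in the cosine series, leaving the
  -- coefficient of `J0`.
  rw [intervalIntegral.integral_const_mul, integral_sin_pow_even, prod_odd_div_even]
  have h2 := Nat.factorial_ne_zero (2 * n)
  have h1 := Nat.factorial_ne_zero n
  rw [div_pow, ← pow_mul]
  field_simp

/-- A shift by `π` flips the sign of `sin φ`, so adding the two half periods cancels the part odd in
`x` and leaves Parseval's integral. -/
lemma integral_cos_add_mul_sin (α x : ℝ) :
    ∫ φ in (0 : ℝ)..(2 * π), cos (α + x * sin φ) = 2 * π * (J0 x * cos α) := by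
  have hc : Continuous fun φ : ℝ => cos (α + x * sin φ) := by fun_prop
  have hshift : ∫ φ in π..(2 * π), cos (α + x * sin φ) =
      ∫ φ in (0 : ℝ)..π, cos (α - x * sin φ) := by
    have h := intervalIntegral.integral_comp_add_right (a := 0) (b := π)
      (fun φ : ℝ => cos (α + x * sin φ)) π
    rw [zero_add, ← two_mul] at h
    rw [← h]
    refine intervalIntegral.integral_congr fun φ _ => ?_
    simp only [sin_add_pi]
    ring_nf
  rw [← intervalIntegral.integral_add_adjacent_intervals (b := π)
    (hc.intervalIntegrable _ _) (hc.intervalIntegrable _ _), hshift,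
    ← intervalIntegral.integral_add (hc.intervalIntegrable _ _)
      (Continuous.intervalIntegrable (by fun_prop) _ _)]
  have h : ∀ φ : ℝ, cos (α + x * sin φ) + cos (α - x * sin φ) =
      2 * cos α * cos (x * sin φ) := by
    intro φ; rw [cos_add, cos_sub]; ring
  simp_rw [h]
  rw [intervalIntegral.integral_const_mul, integral_cos_mul_sin_eq]
  ring

lemma J0_neg (x : ℝ) : J0 (-x) = J0 x := by simp [J0]

/-! ### The sign of `J0` at positive multiples of `π`. -/

lemma integral_cos_mul_cos_eq (x : ℝ) :
    ∫ θ in (0 : ℝ)..(π / 2), cos (x * cos θ) = π / 2 * J0 x := by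
  have hc : Continuous fun θ : ℝ => cos (x * sin θ) := by fun_prop
  have h1 : ∫ θ in (0 : ℝ)..(π / 2), cos (x * cos θ) =
      ∫ θ in (0 : ℝ)..(π / 2), cos (x * sin θ) := by
    have h := intervalIntegral.integral_comp_sub_left (a := 0) (b := π / 2)
      (fun θ : ℝ => cos (x * sin θ)) (π / 2)
    simpa [sin_pi_div_two_sub] using h
  have h2 : ∫ θ in (π / 2)..π, cos (x * sin θ) =
      ∫ θ in (0 : ℝ)..(π / 2), cos (x * sin θ) := by
    have h := intervalIntegral.integral_comp_sub_left (a := 0) (b := π / 2)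
      (fun θ : ℝ => cos (x * sin θ)) π
    rw [sub_zero, sub_half] at h
    rw [← h]
    simp [sin_pi_sub]
  have h3 := intervalIntegral.integral_add_adjacent_intervals (a := 0) (b := π / 2) (c := π)
    (hc.intervalIntegrable (μ := volume) _ _) (hc.intervalIntegrable _ _)
  rw [integral_cos_mul_sin_eq, h2] at h3
  rw [h1]
  linarith

/-- The boundary term of a double integration by parts of `cos (a (1 - cos θ))`. -/
def boundaryTerm (a θ : ℝ) : ℝ :=
  sin (a * (1 - cos θ)) / (a * sin θ)
    + (1 - cos (a * (1 - cos θ))) * cos θ / (a ^ 2 * sin θ ^ 3)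

/-- What is subtracted from the integrand is nonnegative. The second integration by parts takes `1 -
cos`, not `-cos`, as antiderivative of `sin`; this gives the sign and makes the boundary term tend
to `0` at `θ = 0`. -/
lemma hasDerivAt_boundaryTerm {a θ : ℝ} (ha : a ≠ 0) (hθ : sin θ ≠ 0) :
    HasDerivAt (boundaryTerm a)
      (cos (a * (1 - cos θ)) -
        (1 - cos (a * (1 - cos θ))) * (1 + 2 * cos θ ^ 2) / (a ^ 2 * sin θ ^ 4)) θ := by
  have hw : HasDerivAt (fun θ : ℝ => a * (1 - cos θ)) (a * sin θ) θ := by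
    simpa using ((hasDerivAt_cos θ).const_sub 1).const_mul a
  have h1 := hw.sin.fun_div ((hasDerivAt_sin θ).const_mul a) (mul_ne_zero ha hθ)
  have h2 := ((hw.cos.const_sub 1).mul (hasDerivAt_cos θ)).fun_div
    (((hasDerivAt_sin θ).fun_pow 3).const_mul (a ^ 2)) (by positivity)
  refine (h1.add h2).congr_deriv ?_
  have hs : cos θ ^ 2 = 1 - sin θ ^ 2 := by linarith [sin_sq_add_cos_sq θ]
  simp only [Pi.mul_apply]
  field_simp
  ring_nf
  simp only [hs]
  ring

/-- This controls the singular quotients near `θ = 0`: each numerator is bounded by a power of `1 -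
cos θ`, which is of order `sin θ ^ 2`. -/
lemma abs_boundaryTerm_le {a θ : ℝ} (ha : 0 < a) (h0 : 0 ≤ θ) (h1 : θ ≤ π / 2) :
    |boundaryTerm a θ| ≤ 2 * sin θ := by
  rcases h0.eq_or_lt with rfl | h0
  · simp [boundaryTerm]
  have hs : 0 < sin θ := sin_pos_of_pos_of_lt_pi h0 (by linarith [pi_pos])
  have hc : 0 ≤ cos θ := cos_nonneg_of_neg_pi_div_two_le_of_le (by linarith) h1
  have hc1 := cos_le_one θ
  set w := 1 - cos θ with hw
  have hw0 : 0 ≤ w := by linarith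
  -- Since `cos θ ≥ 0`, `1 - cos θ ≤ (1 - cos θ) * (1 + cos θ)`.
  have hws : w ≤ sin θ ^ 2 := by rw [sin_sq]; nlinarith
  have e1 : |sin (a * w) / (a * sin θ)| ≤ sin θ := by
    rw [abs_div, abs_of_pos (mul_pos ha hs), div_le_iff₀ (mul_pos ha hs)]
    calc |sin (a * w)| ≤ |a * w| := abs_sin_le_abs
      _ = a * w := abs_of_nonneg (by positivity)
      _ ≤ a * sin θ ^ 2 := by gcongr
      _ = sin θ * (a * sin θ) := by ring
  have e2 : |(1 - cos (a * w)) * cos θ / (a ^ 2 * sin θ ^ 3)| ≤ sin θ := by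
    have hp : 0 < a ^ 2 * sin θ ^ 3 := by positivity
    have hq : 0 ≤ 1 - cos (a * w) := by linarith [cos_le_one (a * w)]
    rw [abs_of_nonneg (by positivity), div_le_iff₀ hp]
    calc (1 - cos (a * w)) * cos θ ≤ (1 - cos (a * w)) * 1 := by gcongr
      _ ≤ (a * w) ^ 2 := by nlinarith [one_sub_sq_div_two_le_cos (x := a * w), sq_nonneg (a * w)]
      _ ≤ (a * sin θ ^ 2) ^ 2 := by gcongr
      _ = sin θ * (a ^ 2 * sin θ ^ 3) := by ring
  calc |boundaryTerm a θ| ≤ _ + _ := abs_add_le _ _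
    _ ≤ 2 * sin θ := by linarith

lemma continuousOn_boundaryTerm {a : ℝ} (ha : 0 < a) :
    ContinuousOn (boundaryTerm a) (Set.Icc 0 (π / 2)) := by
  intro θ hθ
  rcases hθ.1.eq_or_lt with rfl | h0
  -- Division by zero returns `0` here, which happens to be the limit.
  · have hz : boundaryTerm a 0 = 0 := by simp [boundaryTerm]
    rw [ContinuousWithinAt, hz]
    refine squeeze_zero_norm' (a := fun θ => 2 * sin θ)
      (eventually_nhdsWithin_of_forall fun θ hθ => abs_boundaryTerm_le ha hθ.1 hθ.2) ?_
    have : Filter.Tendsto (fun θ : ℝ => 2 * sin θ) (nhds 0) (nhds (2 * sin 0)) :=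
      Continuous.tendsto (by fun_prop) 0
    rw [sin_zero, mul_zero] at this
    exact this.mono_left nhdsWithin_le_nhds
  · exact (hasDerivAt_boundaryTerm ha.ne'
      (sin_pos_of_pos_of_lt_pi h0 (by linarith [hθ.2, pi_pos])).ne').continuousAt.continuousWithinAt

/-- The primitive minus the boundary term has a nonnegative derivative. Monotonicity of this
difference `K` avoids having to integrate the singular-looking remainder. -/
lemma integral_cos_one_sub_cos_pos {n : ℕ} (hn : 1 ≤ n) :
    0 < ∫ θ in (0 : ℝ)..(π / 2), cos (n * π * (1 - cos θ)) := by
  have hn' : (1 : ℝ) ≤ n := by exact_mod_cast hn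
  set a : ℝ := n * π with ha_def
  have ha : 0 < a := by positivity
  set K : ℝ → ℝ := fun x => (∫ θ in (0 : ℝ)..x, cos (a * (1 - cos θ))) - boundaryTerm a x with hK
  have hcont : Continuous fun θ : ℝ => cos (a * (1 - cos θ)) := by fun_prop
  have hKc : ContinuousOn K (Set.Icc 0 (π / 2)) :=
    (intervalIntegral.continuous_primitive (fun _ _ => hcont.intervalIntegrable _ _)
      0).continuousOn.sub (continuousOn_boundaryTerm ha)
  have hs : ∀ x ∈ Set.Ioo 0 (π / 2), 0 < sin x := fun x hx =>
    sin_pos_of_pos_of_lt_pi hx.1 (by linarith [hx.2, pi_pos])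
  have hKd : ∀ x ∈ Set.Ioo 0 (π / 2), HasDerivAt K
      ((1 - cos (a * (1 - cos x))) * (1 + 2 * cos x ^ 2) / (a ^ 2 * sin x ^ 4)) x := by
    intro x hx
    refine ((hcont.integral_hasStrictDerivAt 0 x).hasDerivAt.sub
      (hasDerivAt_boundaryTerm ha.ne' (hs x hx).ne')).congr_deriv ?_
    ring
  have hmono : MonotoneOn K (Set.Icc 0 (π / 2)) := by
    refine monotoneOn_of_deriv_nonneg (convex_Icc _ _) hKc ?_ ?_
    · rw [interior_Icc]
      exact fun x hx => (hKd x hx).differentiableAt.differentiableWithinAt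
    · rw [interior_Icc]
      intro x hx
      rw [(hKd x hx).deriv]
      have := cos_le_one (a * (1 - cos x))
      have h1 : 0 ≤ 1 - cos (a * (1 - cos x)) := by linarith
      positivity
  have hx0 : (0 : ℝ) < 1 / n := by positivity
  have hx1 : (1 : ℝ) / n ≤ π / 2 := by
    have : (1 : ℝ) / n ≤ 1 := by rw [div_le_one (by linarith)]; exact hn'
    linarith [pi_gt_three]
  -- Inside `(0, 1 / n)` the argument `a * (1 - cos x)` stays strictly between `0` and `2 * π`, so
  -- its cosine is not `1`.
  have hstrict : StrictMonoOn K (Set.Icc 0 (1 / n)) := by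
    refine strictMonoOn_of_deriv_pos (convex_Icc _ _)
      (hKc.mono (Set.Icc_subset_Icc_right hx1)) ?_
    rw [interior_Icc]
    intro x hx
    have hx' : x ∈ Set.Ioo 0 (π / 2) := ⟨hx.1, hx.2.trans_le hx1⟩
    rw [(hKd x hx').deriv]
    have hsx := hs x hx'
    have hcx : cos x < 1 := by
      have := sin_sq_add_cos_sq x
      nlinarith [cos_le_one x]
    have hlt : a * (1 - cos x) < 2 * π := by
      have hb : 1 - cos x ≤ x ^ 2 / 2 := by linarith [one_sub_sq_div_two_le_cos (x := x)]
      have hnx : n * x < 1 := by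
        have := hx.2
        rw [lt_div_iff₀ (by linarith)] at this
        linarith
      have hxlt : x < 1 := by nlinarith [hx.1]
      have : n * (1 - cos x) < 2 := by nlinarith [hx.1]
      calc a * (1 - cos x) = (n * (1 - cos x)) * π := by rw [ha_def]; ring
        _ < 2 * π := by gcongr
    have hpos : 0 < a * (1 - cos x) := mul_pos ha (by linarith)
    have hne : cos (a * (1 - cos x)) < 1 := by
      refine lt_of_le_of_ne (cos_le_one _) fun h => ?_
      rw [cos_eq_one_iff_of_lt_of_lt (by linarith) hlt] at h
      exact hpos.ne' h
    have h1 : 0 < 1 - cos (a * (1 - cos x)) := by linarith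
    positivity
  have hpi : (0 : ℝ) < π / 2 := by positivity
  have h1 : K 0 < K (1 / n) := hstrict ⟨le_rfl, hx0.le⟩ ⟨hx0.le, le_rfl⟩ hx0
  have h2 : K (1 / n) ≤ K (π / 2) := hmono ⟨hx0.le, hx1⟩ ⟨hpi.le, le_rfl⟩ hx1
  have h3 : K 0 = 0 := by simp [hK, boundaryTerm]
  -- The boundary term vanishes at `π / 2` because `sin (n * π) = 0` and `cos (π / 2) = 0`;
  -- integrality of `n` matters here.
  have h4 : K (π / 2) = ∫ θ in (0 : ℝ)..(π / 2), cos (a * (1 - cos θ)) := by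
    simp [hK, boundaryTerm, ha_def, sin_nat_mul_pi]
  linarith

/-- `J₀` alternates in sign along the positive multiples of `π`. -/
lemma neg_one_pow_mul_J0_pos {n : ℕ} (hn : 1 ≤ n) : 0 < (-1 : ℝ) ^ n * J0 (n * π) := by
  have h := integral_cos_one_sub_cos_pos hn
  have h' : ∀ θ : ℝ, cos (n * π * (1 - cos θ)) = (-1 : ℝ) ^ n * cos (n * π * cos θ) := by
    intro θ
    rw [mul_sub, mul_one, cos_sub, cos_nat_mul_pi, sin_nat_mul_pi]
    ring
  simp_rw [h'] at h
  rw [intervalIntegral.integral_const_mul, integral_cos_mul_cos_eq] at h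
  have hpi := pi_pos
  by_contra hcon
  nlinarith

end AASS

/-! ### Closed form of `fAvg`, its upper bound and its maximizers. -/

namespace AASS

open Real

lemma sum_Icc_Icc_succ (g : ℕ → ℕ → ℝ) (n : ℕ) :
    ∑ t ∈ Finset.Icc 1 n, ∑ l ∈ Finset.Icc (t + 1) (n + 1), g t l =
      ∑ t ∈ Finset.Icc 1 (n - 1), ∑ l ∈ Finset.Icc (t + 1) n, g t l
        + ∑ t ∈ Finset.Icc 1 n, g t (n + 1) := by
  have h1 : ∑ t ∈ Finset.Icc 1 n, ∑ l ∈ Finset.Icc (t + 1) (n + 1), g t l =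
      ∑ t ∈ Finset.Icc 1 n, ((∑ l ∈ Finset.Icc (t + 1) n, g t l) + g t (n + 1)) := by
    refine Finset.sum_congr rfl fun t ht => ?_
    rw [Finset.mem_Icc] at ht
    exact Finset.sum_Icc_succ_top (by omega) _
  rw [h1, Finset.sum_add_distrib]
  congr 1
  -- For `n = 0` all ranges are empty despite truncated subtraction; otherwise the extra outer index
  -- `t = n` has an empty inner range.
  cases n with
  | zero => simp
  | succ m => rw [Finset.sum_Icc_succ_top (by omega)]; simp

lemma sq_sum_cos_add_sq_sum_sin (A : ℕ → ℝ) (n : ℕ) :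
    (1 + ∑ t ∈ Finset.Icc 1 n, cos (A t)) ^ 2 + (∑ t ∈ Finset.Icc 1 n, sin (A t)) ^ 2 =
      ((n + 1 : ℕ) : ℝ) + 2 * ∑ t ∈ Finset.Icc 1 n, cos (A t)
        + 2 * ∑ t ∈ Finset.Icc 1 (n - 1), ∑ l ∈ Finset.Icc (t + 1) n, cos (A t - A l) := by
  induction n with
  | zero => simp
  | succ n ih =>
    rw [Nat.add_sub_cancel, sum_Icc_Icc_succ, Finset.sum_Icc_succ_top (by omega),
      Finset.sum_Icc_succ_top (by omega)]
    simp_rw [cos_sub (A _) (A (n + 1))]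
    rw [Finset.sum_add_distrib, ← Finset.sum_mul, ← Finset.sum_mul]
    push_cast at ih ⊢
    linear_combination ih + sin_sq_add_cos_sq (A (n + 1))

lemma fAvg_eq {M : ℕ} (hM : 1 ≤ M) (ψ : ℕ → ℝ) : fAvg M ψ =
    (M : ℝ) + 2 * ∑ t ∈ Finset.Icc 1 (M - 1), J0 ((t : ℝ) * π) * cos (ψ t)
      + 2 * ∑ t ∈ Finset.Icc 1 (M - 2), ∑ l ∈ Finset.Icc (t + 1) (M - 1),
          J0 (((t : ℝ) - (l : ℝ)) * π) * cos (ψ t - ψ l) := by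
  obtain ⟨n, rfl⟩ : ∃ n, M = n + 1 := ⟨M - 1, by omega⟩
  have hsub : n + 1 - 2 = n - 1 := by omega
  have hexp : ∀ φ, fAt (n + 1) ψ φ = ((n + 1 : ℕ) : ℝ)
      + 2 * ∑ t ∈ Finset.Icc 1 n, cos (ψ t + (-((t : ℝ) * π)) * sin φ)
      + 2 * ∑ t ∈ Finset.Icc 1 (n - 1), ∑ l ∈ Finset.Icc (t + 1) n,
          cos (ψ t - ψ l + (-(((t : ℝ) - l) * π)) * sin φ) := by
    intro φ
    rw [fAt, upsilon1, upsilon2, Nat.add_sub_cancel, sq_sum_cos_add_sq_sum_sin]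
    simp only [Phi]
    refine congrArg₂ _ (congrArg₂ _ rfl (congrArg _ (Finset.sum_congr rfl fun t _ => ?_)))
      (congrArg _ (Finset.sum_congr rfl fun t _ => Finset.sum_congr rfl fun l _ => ?_))
    · ring_nf
    · ring_nf
  rw [hsub, Nat.add_sub_cancel, fAvg]
  simp_rw [hexp]
  rw [intervalIntegral.integral_add (Continuous.intervalIntegrable (by fun_prop) _ _)
      (Continuous.intervalIntegrable (by fun_prop) _ _),
    intervalIntegral.integral_add (Continuous.intervalIntegrable (by fun_prop) _ _)
      (Continuous.intervalIntegrable (by fun_prop) _ _),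
    intervalIntegral.integral_const_mul, intervalIntegral.integral_const_mul,
    intervalIntegral.integral_finsetSum
      (fun t _ => Continuous.intervalIntegrable (by fun_prop) _ _),
    intervalIntegral.integral_finsetSum
      (fun t _ => Continuous.intervalIntegrable (by fun_prop) _ _)]
  have hdouble : ∀ t : ℕ, ∫ φ in (0 : ℝ)..(2 * π), ∑ l ∈ Finset.Icc (t + 1) n,
      cos (ψ t - ψ l + (-(((t : ℝ) - l) * π)) * sin φ) =
      2 * π * ∑ l ∈ Finset.Icc (t + 1) n, J0 (((t : ℝ) - l) * π) * cos (ψ t - ψ l) := by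
    intro t
    rw [intervalIntegral.integral_finsetSum
      (fun t _ => Continuous.intervalIntegrable (by fun_prop) _ _), Finset.mul_sum]
    exact Finset.sum_congr rfl fun l _ => by rw [integral_cos_add_mul_sin, J0_neg]
  simp_rw [hdouble, integral_cos_add_mul_sin, J0_neg]
  rw [intervalIntegral.integral_const, ← Finset.mul_sum, ← Finset.mul_sum, smul_eq_mul]
  have := pi_pos
  field_simp
  ring

lemma abs_J0_nat_mul_pi {t : ℕ} (ht : 1 ≤ t) : |J0 (t * π)| = (-1 : ℝ) ^ t * J0 (t * π) := by
  rw [← abs_of_pos (neg_one_pow_mul_J0_pos ht), abs_mul, abs_pow, abs_neg, abs_one, one_pow,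
    one_mul]

/-- `J0` is even, and `t + l` has the parity of `l - t`. -/
lemma abs_J0_sub_mul_pi {t l : ℕ} (h : t < l) :
    |J0 (((t : ℝ) - l) * π)| = (-1 : ℝ) ^ (t + l) * J0 (((t : ℝ) - l) * π) := by
  obtain ⟨k, rfl⟩ := Nat.exists_eq_add_of_lt h
  have e : ((t : ℝ) - ((t + k + 1 : ℕ) : ℝ)) * π = -(((k + 1 : ℕ) : ℝ) * π) := by
    push_cast; ring
  have e' : (-1 : ℝ) ^ (t + (t + k + 1)) = (-1) ^ (k + 1) := by
    rw [show t + (t + k + 1) = 2 * t + (k + 1) by ring, pow_add, pow_mul]; simp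
  rw [e, e', J0_neg, abs_J0_nat_mul_pi (by omega)]

lemma fUpper_sub_fAvg {M : ℕ} (hM : 1 ≤ M) (ψ : ℕ → ℝ) : fUpper M - fAvg M ψ =
    2 * ∑ t ∈ Finset.Icc 1 (M - 1), |J0 ((t : ℝ) * π)| * (1 - (-1) ^ t * cos (ψ t))
      + 2 * ∑ t ∈ Finset.Icc 1 (M - 2), ∑ l ∈ Finset.Icc (t + 1) (M - 1),
          |J0 (((t : ℝ) - (l : ℝ)) * π)| * (1 - (-1) ^ (t + l) * cos (ψ t - ψ l)) := by
  have hsq : ∀ k : ℕ, ((-1 : ℝ) ^ k) * (-1) ^ k = 1 := fun k => by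
    rw [← mul_pow]; simp
  have h1 : ∑ t ∈ Finset.Icc 1 (M - 1), |J0 ((t : ℝ) * π)| * (1 - (-1) ^ t * cos (ψ t)) =
      ∑ t ∈ Finset.Icc 1 (M - 1), |J0 ((t : ℝ) * π)|
        - ∑ t ∈ Finset.Icc 1 (M - 1), J0 ((t : ℝ) * π) * cos (ψ t) := by
    rw [← Finset.sum_sub_distrib]
    refine Finset.sum_congr rfl fun t ht => ?_
    rw [Finset.mem_Icc] at ht
    rw [abs_J0_nat_mul_pi ht.1]
    linear_combination (-J0 (t * π) * cos (ψ t)) * hsq t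
  have h2 : ∑ t ∈ Finset.Icc 1 (M - 2), ∑ l ∈ Finset.Icc (t + 1) (M - 1),
      |J0 (((t : ℝ) - (l : ℝ)) * π)| * (1 - (-1) ^ (t + l) * cos (ψ t - ψ l)) =
      ∑ t ∈ Finset.Icc 1 (M - 2), ∑ l ∈ Finset.Icc (t + 1) (M - 1),
        |J0 (((t : ℝ) - (l : ℝ)) * π)|
      - ∑ t ∈ Finset.Icc 1 (M - 2), ∑ l ∈ Finset.Icc (t + 1) (M - 1),
        J0 (((t : ℝ) - (l : ℝ)) * π) * cos (ψ t - ψ l) := by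
    rw [← Finset.sum_sub_distrib]
    refine Finset.sum_congr rfl fun t _ => ?_
    rw [← Finset.sum_sub_distrib]
    refine Finset.sum_congr rfl fun l hl => ?_
    rw [Finset.mem_Icc] at hl
    rw [abs_J0_sub_mul_pi (by omega)]
    linear_combination (-J0 (((t : ℝ) - l) * π) * cos (ψ t - ψ l)) * hsq (t + l)
  rw [fAvg_eq hM, fUpper, h1, h2]
  ring

lemma one_sub_neg_one_pow_mul_cos_nonneg (k : ℕ) (x : ℝ) : 0 ≤ 1 - (-1 : ℝ) ^ k * cos x := by
  have h : |(-1 : ℝ) ^ k * cos x| ≤ 1 := by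
    rw [abs_mul, abs_pow, abs_neg, abs_one, one_pow, one_mul]
    exact abs_cos_le_one x
  linarith [le_abs_self ((-1 : ℝ) ^ k * cos x)]

lemma one_sub_neg_one_pow_mul_cos_eq_zero {k : ℕ} {x : ℝ} :
    1 - (-1 : ℝ) ^ k * cos x = 0 ↔ cos x = (-1) ^ k := by
  rcases neg_one_pow_eq_or ℝ k with h | h <;> rw [h] <;>
    constructor <;> intro h' <;> linarith

lemma fAvg_le_fUpper {M : ℕ} (hM : 1 ≤ M) (ψ : ℕ → ℝ) : fAvg M ψ ≤ fUpper M := by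
  rw [← sub_nonneg, fUpper_sub_fAvg hM]
  refine add_nonneg (mul_nonneg two_pos.le (Finset.sum_nonneg fun t _ => ?_))
    (mul_nonneg two_pos.le (Finset.sum_nonneg fun t _ => Finset.sum_nonneg fun l _ => ?_)) <;>
  exact mul_nonneg (abs_nonneg _) (one_sub_neg_one_pow_mul_cos_nonneg _ _)

lemma sin_eq_zero_of_cos_eq_neg_one_pow {k : ℕ} {x : ℝ} (h : cos x = (-1) ^ k) : sin x = 0 := by
  have := sin_sq_add_cos_sq x
  rw [h, ← pow_mul, mul_comm k 2, pow_mul] at this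
  simpa using this

/-- Equality kills each nonnegative term of the deficit, and the weights `|J0 (t * π)|` are nonzero.
Conversely, these conditions make all the sines vanish, so the pair terms vanish as well. -/
lemma fAvg_eq_fUpper_iff {M : ℕ} (hM : 1 ≤ M) (ψ : ℕ → ℝ) :
    fAvg M ψ = fUpper M ↔ ∀ t ∈ Finset.Icc 1 (M - 1), cos (ψ t) = (-1) ^ t := by
  constructor
  · intro h t ht
    have hsum := fUpper_sub_fAvg hM ψ
    rw [h, sub_self] at hsum
    have h1 : ∀ t ∈ Finset.Icc 1 (M - 1),
        0 ≤ |J0 ((t : ℝ) * π)| * (1 - (-1) ^ t * cos (ψ t)) := fun t _ =>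
      mul_nonneg (abs_nonneg _) (one_sub_neg_one_pow_mul_cos_nonneg _ _)
    have h2 : 0 ≤ ∑ t ∈ Finset.Icc 1 (M - 2), ∑ l ∈ Finset.Icc (t + 1) (M - 1),
        |J0 (((t : ℝ) - (l : ℝ)) * π)| * (1 - (-1) ^ (t + l) * cos (ψ t - ψ l)) :=
      Finset.sum_nonneg fun t _ => Finset.sum_nonneg fun l _ =>
        mul_nonneg (abs_nonneg _) (one_sub_neg_one_pow_mul_cos_nonneg _ _)
    have h3 : ∑ t ∈ Finset.Icc 1 (M - 1),
        |J0 ((t : ℝ) * π)| * (1 - (-1) ^ t * cos (ψ t)) = 0 :=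
      le_antisymm (by linarith) (Finset.sum_nonneg h1)
    have h4 := (Finset.sum_eq_zero_iff_of_nonneg h1).1 h3 t ht
    have hJ : |J0 ((t : ℝ) * π)| ≠ 0 := by
      have ht1 := (Finset.mem_Icc.1 ht).1
      rw [abs_J0_nat_mul_pi ht1]
      exact (neg_one_pow_mul_J0_pos ht1).ne'
    exact one_sub_neg_one_pow_mul_cos_eq_zero.1 ((mul_eq_zero.1 h4).resolve_left hJ)
  · intro h
    rw [eq_comm, ← sub_eq_zero, fUpper_sub_fAvg hM, Finset.sum_eq_zero, Finset.sum_eq_zero]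
    · simp
    · intro t ht
      refine Finset.sum_eq_zero fun l hl => ?_
      rw [Finset.mem_Icc] at ht hl
      have e1 := h t (Finset.mem_Icc.2 ⟨ht.1, by omega⟩)
      have e2 := h l (Finset.mem_Icc.2 ⟨by omega, hl.2⟩)
      rw [one_sub_neg_one_pow_mul_cos_eq_zero.2, mul_zero]
      rw [cos_sub, sin_eq_zero_of_cos_eq_neg_one_pow e1, e1, e2, pow_add]
      ring
    · intro t ht
      rw [one_sub_neg_one_pow_mul_cos_eq_zero.2 (h t ht), mul_zero]

lemma cos_psiOpt (t : ℕ) : cos (psiOpt t) = (-1) ^ t := by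
  rw [psiOpt]
  rcases Nat.even_or_odd t with h | h
  · simp [Nat.even_iff.1 h, h.neg_one_pow]
  · simp [Nat.odd_iff.1 h, h.neg_one_pow]

lemma fAvg_psiOpt {M : ℕ} (hM : 1 ≤ M) : fAvg M psiOpt = fUpper M :=
  (fAvg_eq_fUpper_iff hM _).2 fun t _ => cos_psiOpt t

lemma psiOpt_mem_admissible (M : ℕ) : psiOpt ∈ admissible M := by
  refine ⟨by simp [psiOpt], fun t _ => ?_⟩
  rw [psiOpt]
  have hpi := pi_pos
  have h : ((t % 2 : ℕ) : ℝ) ≤ 1 := by exact_mod_cast (by omega : t % 2 ≤ 1)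
  constructor
  · positivity
  · nlinarith

/-- The anchor `ψ 0 = 0` turns conditions on neighbours into conditions on each phase, by induction.
-/
lemma consecutivePiShifted_iff {M : ℕ} {ψ : ℕ → ℝ} (h0 : ψ 0 = 0) :
    ConsecutivePiShifted M ψ ↔ ∀ t ∈ Finset.Icc 1 (M - 1), cos (ψ t) = (-1) ^ t := by
  constructor
  · intro h
    have key : ∀ t, t < M → cos (ψ t) = (-1) ^ t := by
      intro t
      induction t with
      | zero => simp [h0]
      | succ t ih =>
        intro ht
        obtain ⟨k, hk⟩ := h t ht
        have e : ψ (t + 1) = ψ t + π + k * (2 * π) := by linarith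
        rw [e, cos_add_int_mul_two_pi, cos_add_pi, ih (by omega), pow_succ]
        ring
    intro t ht
    rw [Finset.mem_Icc] at ht
    exact key t (by omega)
  · intro h t ht
    have e : ∀ s, s < M → cos (ψ s) = (-1) ^ s := by
      intro s hs
      rcases Nat.eq_zero_or_pos s with rfl | hpos
      · simp [h0]
      · exact h s (Finset.mem_Icc.2 ⟨hpos, by omega⟩)
    have hcos : cos (ψ (t + 1) - ψ t) = -1 := by
      rw [cos_sub, sin_eq_zero_of_cos_eq_neg_one_pow (e t (by omega)), e t (by omega), e _ ht,
        pow_succ, mul_zero, add_zero]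
      rcases neg_one_pow_eq_or ℝ t with h' | h' <;> rw [h'] <;> norm_num
    obtain ⟨k, hk⟩ := cos_eq_neg_one_iff.1 hcos
    exact ⟨k, by linarith⟩

lemma isMaxOn_fAvg_psiOpt {M : ℕ} (hM : 1 ≤ M) :
    IsMaxOn (fAvg M) (admissible M) psiOpt := by
  intro ψ _
  simpa [fAvg_psiOpt hM] using fAvg_le_fUpper hM ψ

lemma isMaxOn_fAvg_iff {M : ℕ} (hM : 1 ≤ M) {ψ : ℕ → ℝ} (hψ : ψ ∈ admissible M) :
    IsMaxOn (fAvg M) (admissible M) ψ ↔ ConsecutivePiShifted M ψ := by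
  rw [consecutivePiShifted_iff hψ.1, ← fAvg_eq_fUpper_iff hM]
  constructor
  · intro h
    refine le_antisymm (fAvg_le_fUpper hM ψ) ?_
    rw [← fAvg_psiOpt hM]
    exact h (psiOpt_mem_admissible M)
  · intro h ψ' _
    simpa [h] using fAvg_le_fUpper hM ψ'

end AASS

/-! ### Second moments of the complex Gaussian scattering. -/

namespace AASS

section Gaussian

variable {ι : Type*} [Fintype ι] [DecidableEq ι] {S : Matrix ι ι ℝ}

lemma memLp_eval_multivariateGaussian (μ : EuclideanSpace ℝ ι) (S : Matrix ι ι ℝ) (i : ι) :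
    MemLp (fun x : EuclideanSpace ℝ ι => x i) 2 (multivariateGaussian μ S) :=
  IsGaussian.memLp_dual (multivariateGaussian μ S)
    (EuclideanSpace.proj i : EuclideanSpace ℝ ι →L[ℝ] ℝ) 2 (by simp)

lemma integrable_eval_multivariateGaussian (μ : EuclideanSpace ℝ ι) (S : Matrix ι ι ℝ) (i : ι) :
    Integrable (fun x : EuclideanSpace ℝ ι => x i) (multivariateGaussian μ S) :=
  (memLp_eval_multivariateGaussian μ S i).integrable (by norm_num)

lemma integral_eval_multivariateGaussian (S : Matrix ι ι ℝ) (i : ι) :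
    ∫ x, x i ∂(multivariateGaussian (0 : EuclideanSpace ℝ ι) S) = 0 := by
  have h := (EuclideanSpace.proj i : EuclideanSpace ℝ ι →L[ℝ] ℝ).integral_comp_comm
    (IsGaussian.integrable_fun_id (μ := multivariateGaussian (0 : EuclideanSpace ℝ ι) S))
  simpa using h

lemma integrable_eval_mul_eval_multivariateGaussian (μ : EuclideanSpace ℝ ι) (S : Matrix ι ι ℝ)
    (i j : ι) :
    Integrable (fun x : EuclideanSpace ℝ ι => x i * x j) (multivariateGaussian μ S) :=
  (memLp_eval_multivariateGaussian μ S i).integrable_mul (memLp_eval_multivariateGaussian μ S j)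

lemma integral_eval_mul_eval_multivariateGaussian (hS : S.PosSemidef) (i j : ι) :
    ∫ x, x i * x j ∂(multivariateGaussian (0 : EuclideanSpace ℝ ι) S) = S i j := by
  have h := covariance_eval_multivariateGaussian (μ := (0 : EuclideanSpace ℝ ι)) hS i j
  rw [covariance_eq_sub (memLp_eval_multivariateGaussian _ S i)
    (memLp_eval_multivariateGaussian _ S j), integral_eval_multivariateGaussian] at h
  simpa using h

end Gaussian

variable {M : ℕ}

lemma measurable_complexOfParts :
    Measurable (fun (p : EuclideanSpace ℝ (Fin M) × EuclideanSpace ℝ (Fin M)) (j : Fin M) =>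
      (⟨p.1 j, p.2 j⟩ : ℂ)) := by
  refine measurable_pi_lambda _ fun j => ?_
  have : (fun p : EuclideanSpace ℝ (Fin M) × EuclideanSpace ℝ (Fin M) =>
      (⟨p.1 j, p.2 j⟩ : ℂ)) = fun p => Complex.equivRealProdCLM.symm (p.1 j, p.2 j) := by
    funext p
    exact Complex.ext (by simp) (by simp)
  rw [this]
  fun_prop

instance isProbabilityMeasure_complexGaussian (R : Matrix (Fin M) (Fin M) ℝ) :
    IsProbabilityMeasure (complexGaussian R) :=
  Measure.isProbabilityMeasure_map measurable_complexOfParts.aemeasurable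

lemma integrable_complexGaussian_iff (R : Matrix (Fin M) (Fin M) ℝ) {g : (Fin M → ℂ) → ℝ}
    (hg : Continuous g) : Integrable g (complexGaussian R) ↔
      Integrable (fun p : EuclideanSpace ℝ (Fin M) × EuclideanSpace ℝ (Fin M) =>
        g fun j => ⟨p.1 j, p.2 j⟩) ((multivariateGaussian 0 ((1 / 2 : ℝ) • R)).prod
          (multivariateGaussian 0 ((1 / 2 : ℝ) • R))) :=
  integrable_map_measure hg.aestronglyMeasurable measurable_complexOfParts.aemeasurable

lemma integral_complexGaussian (R : Matrix (Fin M) (Fin M) ℝ) {g : (Fin M → ℂ) → ℝ}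
    (hg : Continuous g) : ∫ z, g z ∂(complexGaussian R) =
      ∫ p : EuclideanSpace ℝ (Fin M) × EuclideanSpace ℝ (Fin M),
        g (fun j => ⟨p.1 j, p.2 j⟩) ∂((multivariateGaussian 0 ((1 / 2 : ℝ) • R)).prod
          (multivariateGaussian 0 ((1 / 2 : ℝ) • R))) :=
  integral_map measurable_complexOfParts.aemeasurable hg.aestronglyMeasurable

lemma integrable_re_complexGaussian (R : Matrix (Fin M) (Fin M) ℝ) (i : Fin M) :
    Integrable (fun z : Fin M → ℂ => (z i).re) (complexGaussian R) := by
  rw [integrable_complexGaussian_iff R (by fun_prop)]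
  exact (integrable_eval_multivariateGaussian _ _ i).comp_fst _

lemma integrable_im_complexGaussian (R : Matrix (Fin M) (Fin M) ℝ) (i : Fin M) :
    Integrable (fun z : Fin M → ℂ => (z i).im) (complexGaussian R) := by
  rw [integrable_complexGaussian_iff R (by fun_prop)]
  exact (integrable_eval_multivariateGaussian _ _ i).comp_snd _

lemma integral_re_complexGaussian (R : Matrix (Fin M) (Fin M) ℝ) (i : Fin M) :
    ∫ z, (z i).re ∂(complexGaussian R) = 0 := by
  rw [integral_complexGaussian R (by fun_prop),
    integral_fun_fst (fun x : EuclideanSpace ℝ (Fin M) => x i),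
    integral_eval_multivariateGaussian, smul_zero]

lemma integral_im_complexGaussian (R : Matrix (Fin M) (Fin M) ℝ) (i : Fin M) :
    ∫ z, (z i).im ∂(complexGaussian R) = 0 := by
  rw [integral_complexGaussian R (by fun_prop),
    integral_fun_snd (fun x : EuclideanSpace ℝ (Fin M) => x i),
    integral_eval_multivariateGaussian, smul_zero]

lemma integrable_re_mul_re_complexGaussian (R : Matrix (Fin M) (Fin M) ℝ) (i j : Fin M) :
    Integrable (fun z : Fin M → ℂ => (z i).re * (z j).re) (complexGaussian R) := by
  rw [integrable_complexGaussian_iff R (by fun_prop)]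
  exact (integrable_eval_mul_eval_multivariateGaussian _ _ i j).comp_fst _

lemma integrable_im_mul_im_complexGaussian (R : Matrix (Fin M) (Fin M) ℝ) (i j : Fin M) :
    Integrable (fun z : Fin M → ℂ => (z i).im * (z j).im) (complexGaussian R) := by
  rw [integrable_complexGaussian_iff R (by fun_prop)]
  exact (integrable_eval_mul_eval_multivariateGaussian _ _ i j).comp_snd _

lemma integrable_re_mul_im_complexGaussian (R : Matrix (Fin M) (Fin M) ℝ) (i j : Fin M) :
    Integrable (fun z : Fin M → ℂ => (z i).re * (z j).im) (complexGaussian R) := by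
  rw [integrable_complexGaussian_iff R (by fun_prop)]
  exact (integrable_eval_multivariateGaussian _ _ i).mul_prod
    (integrable_eval_multivariateGaussian _ _ j)

lemma integral_re_mul_re_complexGaussian {R : Matrix (Fin M) (Fin M) ℝ} (hR : R.PosSemidef)
    (i j : Fin M) : ∫ z, (z i).re * (z j).re ∂(complexGaussian R) = R i j / 2 := by
  rw [integral_complexGaussian R (by fun_prop),
    integral_fun_fst (fun x : EuclideanSpace ℝ (Fin M) => x i * x j),
    integral_eval_mul_eval_multivariateGaussian (hR.smul (by norm_num))]
  simp
  ring

lemma integral_im_mul_im_complexGaussian {R : Matrix (Fin M) (Fin M) ℝ} (hR : R.PosSemidef)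
    (i j : Fin M) : ∫ z, (z i).im * (z j).im ∂(complexGaussian R) = R i j / 2 := by
  rw [integral_complexGaussian R (by fun_prop),
    integral_fun_snd (fun x : EuclideanSpace ℝ (Fin M) => x i * x j),
    integral_eval_mul_eval_multivariateGaussian (hR.smul (by norm_num))]
  simp
  ring

lemma integral_re_mul_im_complexGaussian (R : Matrix (Fin M) (Fin M) ℝ) (i j : Fin M) :
    ∫ z, (z i).re * (z j).im ∂(complexGaussian R) = 0 := by
  rw [integral_complexGaussian R (by fun_prop),
    integral_prod_mul (fun x : EuclideanSpace ℝ (Fin M) => x i)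
      (fun x : EuclideanSpace ℝ (Fin M) => x j),
    integral_eval_multivariateGaussian, zero_mul]

lemma re_sum_mul (w z : Fin M → ℂ) :
    (∑ j, w j * z j).re = ∑ j, ((w j).re * (z j).re - (w j).im * (z j).im) := by
  simp [Complex.mul_re]

lemma im_sum_mul (w z : Fin M → ℂ) :
    (∑ j, w j * z j).im = ∑ j, ((w j).re * (z j).im + (w j).im * (z j).re) := by
  simp [Complex.mul_im]

lemma integrable_re_sum_mul (R : Matrix (Fin M) (Fin M) ℝ) (w : Fin M → ℂ) :
    Integrable (fun z : Fin M → ℂ => (∑ j, w j * z j).re) (complexGaussian R) := by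
  simp_rw [re_sum_mul]
  exact integrable_finsetSum _ fun j _ => ((integrable_re_complexGaussian R j).const_mul _).sub
    ((integrable_im_complexGaussian R j).const_mul _)

lemma integrable_im_sum_mul (R : Matrix (Fin M) (Fin M) ℝ) (w : Fin M → ℂ) :
    Integrable (fun z : Fin M → ℂ => (∑ j, w j * z j).im) (complexGaussian R) := by
  simp_rw [im_sum_mul]
  exact integrable_finsetSum _ fun j _ => ((integrable_im_complexGaussian R j).const_mul _).add
    ((integrable_re_complexGaussian R j).const_mul _)

lemma integral_re_sum_mul (R : Matrix (Fin M) (Fin M) ℝ) (w : Fin M → ℂ) :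
    ∫ z, (∑ j, w j * z j).re ∂(complexGaussian R) = 0 := by
  simp_rw [re_sum_mul]
  rw [integral_finsetSum _ fun j _ => by
    exact ((integrable_re_complexGaussian R j).const_mul _).sub
      ((integrable_im_complexGaussian R j).const_mul _)]
  refine Finset.sum_eq_zero fun j _ => ?_
  rw [integral_sub ((integrable_re_complexGaussian R j).const_mul _)
    ((integrable_im_complexGaussian R j).const_mul _), integral_const_mul, integral_const_mul,
    integral_re_complexGaussian, integral_im_complexGaussian]
  simp

lemma integral_im_sum_mul (R : Matrix (Fin M) (Fin M) ℝ) (w : Fin M → ℂ) :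
    ∫ z, (∑ j, w j * z j).im ∂(complexGaussian R) = 0 := by
  simp_rw [im_sum_mul]
  rw [integral_finsetSum _ fun j _ => ((integrable_im_complexGaussian R j).const_mul _).fun_add
    ((integrable_re_complexGaussian R j).const_mul _)]
  refine Finset.sum_eq_zero fun j _ => ?_
  rw [integral_add ((integrable_im_complexGaussian R j).const_mul _)
    ((integrable_re_complexGaussian R j).const_mul _), integral_const_mul, integral_const_mul,
    integral_re_complexGaussian, integral_im_complexGaussian]
  simp

/-- The real and imaginary correlations are separated from the mixed products, whose means vanish
under `complexGaussian`. The former contribute `R i j / 2` each. -/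
lemma sq_norm_sum_mul (w z : Fin M → ℂ) : ‖∑ j, w j * z j‖ ^ 2 =
    ∑ i, ∑ j, (((w i).re * (w j).re + (w i).im * (w j).im) *
        ((z i).re * (z j).re + (z i).im * (z j).im)
      + ((w i).re * (w j).im - (w i).im * (w j).re) *
        ((z j).re * (z i).im - (z i).re * (z j).im)) := by
  rw [Complex.sq_norm, Complex.normSq_apply, re_sum_mul, im_sum_mul, Finset.sum_mul_sum,
    Finset.sum_mul_sum, ← Finset.sum_add_distrib]
  refine Finset.sum_congr rfl fun i _ => ?_
  rw [← Finset.sum_add_distrib]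
  exact Finset.sum_congr rfl fun j _ => by ring

lemma integrable_and_integral_sq_norm_sum_mul {R : Matrix (Fin M) (Fin M) ℝ} (hR : R.PosSemidef)
    (w : Fin M → ℂ) :
    Integrable (fun z : Fin M → ℂ => ‖∑ j, w j * z j‖ ^ 2) (complexGaussian R) ∧
      ∫ z, ‖∑ j, w j * z j‖ ^ 2 ∂(complexGaussian R) =
        ∑ i, ∑ j, ((w i).re * (w j).re + (w i).im * (w j).im) * R i j := by
  have h1 : ∀ i j, Integrable (fun z : Fin M → ℂ =>
      ((w i).re * (w j).re + (w i).im * (w j).im) *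
        ((z i).re * (z j).re + (z i).im * (z j).im)) (complexGaussian R) := fun i j =>
    ((integrable_re_mul_re_complexGaussian R i j).fun_add
      (integrable_im_mul_im_complexGaussian R i j)).const_mul _
  have h2 : ∀ i j, Integrable (fun z : Fin M → ℂ =>
      ((w i).re * (w j).im - (w i).im * (w j).re) *
        ((z j).re * (z i).im - (z i).re * (z j).im)) (complexGaussian R) := fun i j =>
    Integrable.const_mul ((integrable_re_mul_im_complexGaussian R j i).sub
      (integrable_re_mul_im_complexGaussian R i j)) _
  have h3 := fun i j => (h1 i j).fun_add (h2 i j)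
  have h4 := fun i => integrable_finsetSum Finset.univ fun j _ => h3 i j
  simp_rw [sq_norm_sum_mul]
  refine ⟨integrable_finsetSum _ fun i _ => h4 i, ?_⟩
  rw [integral_finsetSum _ fun i _ => h4 i]
  refine Finset.sum_congr rfl fun i _ => ?_
  rw [integral_finsetSum _ fun j _ => h3 i j]
  refine Finset.sum_congr rfl fun j _ => ?_
  rw [integral_add (h1 i j) (h2 i j), integral_const_mul, integral_const_mul,
    integral_add (integrable_re_mul_re_complexGaussian R i j)
      (integrable_im_mul_im_complexGaussian R i j),
    integral_sub (integrable_re_mul_im_complexGaussian R j i)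
      (integrable_re_mul_im_complexGaussian R i j),
    integral_re_mul_re_complexGaussian hR, integral_im_mul_im_complexGaussian hR,
    integral_re_mul_im_complexGaussian, integral_re_mul_im_complexGaussian]
  ring

/-- A random signal with zero mean, independent of the azimuth, adds its mean energy to the mean
energy of a signal that depends on the azimuth only. -/
lemma integrable_and_integral_sq_norm_add {R : Matrix (Fin M) (Fin M) ℝ} (hR : R.PosSemidef)
    (w : Fin M → ℂ) {U : Measure ℝ} [IsProbabilityMeasure U] {c : ℝ → ℂ} (hc : MemLp c 2 U) :
    Integrable (fun p : ℝ × (Fin M → ℂ) => ‖c p.1 + ∑ j, w j * p.2 j‖ ^ 2)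
        (U.prod (complexGaussian R)) ∧
      ∫ p, ‖c p.1 + ∑ j, w j * p.2 j‖ ^ 2 ∂(U.prod (complexGaussian R)) =
        ∫ φ, ‖c φ‖ ^ 2 ∂U + ∑ i, ∑ j, ((w i).re * (w j).re + (w i).im * (w j).im) * R i j := by
  obtain ⟨hZ, hZ'⟩ := integrable_and_integral_sq_norm_sum_mul hR w
  have hexp : ∀ p : ℝ × (Fin M → ℂ), ‖c p.1 + ∑ j, w j * p.2 j‖ ^ 2 =
      ‖c p.1‖ ^ 2 + ‖∑ j, w j * p.2 j‖ ^ 2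
        + 2 * ((c p.1).re * (∑ j, w j * p.2 j).re + (c p.1).im * (∑ j, w j * p.2 j).im) := by
    intro p
    simp only [Complex.sq_norm, Complex.normSq_apply, Complex.add_re, Complex.add_im]
    ring
  have hc1 : Integrable c U := hc.integrable (by norm_num)
  have i1 : Integrable (fun p : ℝ × (Fin M → ℂ) => ‖c p.1‖ ^ 2) (U.prod (complexGaussian R)) :=
    Integrable.comp_fst (f := fun φ => ‖c φ‖ ^ 2) (hc.integrable_norm_pow (p := 2) (by norm_num)) _
  have i2 := hZ.comp_snd U
  have i3 : Integrable (fun p : ℝ × (Fin M → ℂ) => (c p.1).re * (∑ j, w j * p.2 j).re)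
      (U.prod (complexGaussian R)) := hc1.re.mul_prod (integrable_re_sum_mul R w)
  have i4 : Integrable (fun p : ℝ × (Fin M → ℂ) => (c p.1).im * (∑ j, w j * p.2 j).im)
      (U.prod (complexGaussian R)) := hc1.im.mul_prod (integrable_im_sum_mul R w)
  simp_rw [hexp]
  refine ⟨(i1.fun_add i2).fun_add ((i3.fun_add i4).const_mul 2), ?_⟩
  rw [integral_add (i1.fun_add i2) ((i3.fun_add i4).const_mul 2), integral_add i1 i2,
    integral_const_mul, integral_add i3 i4,
    integral_prod_mul (fun φ => (c φ).re) (fun z : Fin M → ℂ => (∑ j, w j * z j).re),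
    integral_prod_mul (fun φ => (c φ).im) (fun z : Fin M → ℂ => (∑ j, w j * z j).im),
    integral_re_sum_mul, integral_im_sum_mul, ← hZ']
  have e1 := integral_fun_fst (μ := U) (ν := complexGaussian R) (fun φ => ‖c φ‖ ^ 2)
  have e2 := integral_fun_snd (μ := U) (ν := complexGaussian R)
    (fun z : Fin M → ℂ => ‖∑ j, w j * z j‖ ^ 2)
  rw [e1, e2]
  simp

end AASS

/-! ### Average incident RF energy of the Rician channel. -/

namespace AASS

variable {M : ℕ}

lemma volume_Icc_two_pi_ne_zero : volume (Set.Icc (0 : ℝ) (2 * Real.pi)) ≠ 0 := by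
  simp [Real.pi_pos]

instance isProbabilityMeasure_cond_Icc_two_pi :
    IsProbabilityMeasure (cond (volume : Measure ℝ) (Set.Icc 0 (2 * Real.pi))) :=
  cond_isProbabilityMeasure_of_finite volume_Icc_two_pi_ne_zero measure_Icc_lt_top.ne

lemma integral_cond_Icc_two_pi (g : ℝ → ℝ) :
    ∫ φ, g φ ∂(cond (volume : Measure ℝ) (Set.Icc 0 (2 * Real.pi))) =
      1 / (2 * Real.pi) * ∫ φ in (0 : ℝ)..(2 * Real.pi), g φ := by
  have hpi := Real.pi_pos
  rw [ProbabilityTheory.cond, integral_smul_measure, integral_Icc_eq_integral_Ioc,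
    intervalIntegral.integral_of_le (by positivity), Real.volume_Icc, sub_zero,
    ENNReal.toReal_inv, ENNReal.toReal_ofReal (by positivity), smul_eq_mul, one_div]

/-- The sum of the line-of-sight components, without their common factor. -/
def steeringSum (M : ℕ) (ψ : ℕ → ℝ) (φ : ℝ) : ℂ :=
  ∑ j : Fin M, Complex.exp (Complex.I * ((Phi (j : ℕ) φ + ψ (j : ℕ) : ℝ) : ℂ))

lemma continuous_steeringSum (M : ℕ) (ψ : ℕ → ℝ) : Continuous (steeringSum M ψ) := by
  unfold steeringSum Phi
  fun_prop

lemma sum_fin_eq_zero_add_sum_Icc (hM : 1 ≤ M) (g : ℕ → ℝ) :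
    ∑ j : Fin M, g j = g 0 + ∑ t ∈ Finset.Icc 1 (M - 1), g t := by
  obtain ⟨n, rfl⟩ : ∃ n, M = n + 1 := ⟨M - 1, by omega⟩
  rw [Fin.sum_univ_eq_sum_range, Finset.range_eq_Ico, Finset.sum_eq_sum_Ico_succ_bot (by omega)]
  rfl

/-- Antenna `0` contributes the constant `1` of `upsilon1`, thanks to `ψ 0 = 0`. -/
lemma sq_norm_steeringSum (hM : 1 ≤ M) {ψ : ℕ → ℝ} (h0 : ψ 0 = 0) (φ : ℝ) :
    ‖steeringSum M ψ φ‖ ^ 2 = fAt M ψ φ := by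
  have hre : (steeringSum M ψ φ).re = upsilon1 M ψ φ := by
    rw [steeringSum, Complex.re_sum, upsilon1]
    simp_rw [mul_comm Complex.I, Complex.exp_ofReal_mul_I_re]
    rw [sum_fin_eq_zero_add_sum_Icc hM (fun t => Real.cos (Phi t φ + ψ t))]
    simp [h0, Phi, add_comm]
  have him : (steeringSum M ψ φ).im = upsilon2 M ψ φ := by
    rw [steeringSum, Complex.im_sum, upsilon2]
    simp_rw [mul_comm Complex.I, Complex.exp_ofReal_mul_I_im]
    rw [sum_fin_eq_zero_add_sum_Icc hM (fun t => Real.sin (Phi t φ + ψ t))]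
    simp [h0, Phi, add_comm]
  rw [Complex.sq_norm, Complex.normSq_apply, hre, him, fAt]
  ring

lemma norm_exp_I_mul_ofReal (x : ℝ) : ‖Complex.exp (Complex.I * (x : ℂ))‖ = 1 := by
  rw [mul_comm]
  exact Complex.norm_exp_ofReal_mul_I x

/-- Mean energy of a Rician channel whose scattering component has weights `w`. -/
lemma integrable_and_integral_rician (hM : 1 ≤ M) (β : ℝ) {κ : ℝ} (φ₀ : ℝ) (hκ : 0 ≤ κ)
    {R : Matrix (Fin M) (Fin M) ℝ} (hR : R.PosSemidef) {ψ : ℕ → ℝ} (h0 : ψ 0 = 0)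
    (w : Fin M → ℂ) {H : ℝ × (Fin M → ℂ) → Fin M → ℂ}
    (hH : ∀ p, ∑ j, H p j = (Real.sqrt (κ / (1 + κ)) : ℂ) * Complex.exp (Complex.I * (φ₀ : ℂ))
      * steeringSum M ψ p.1 + ∑ j, ((Real.sqrt (1 / (1 + κ)) : ℂ) * w j) * p.2 j) :
    Integrable (fun p => rfEnergy β (H p)) (jointLaw R) ∧
      ∫ p, rfEnergy β (H p) ∂(jointLaw R) = β / ((M : ℝ) * (κ + 1)) *
        ((∑ i, ∑ j, ((w i).re * (w j).re + (w i).im * (w j).im) * R i j) + κ * fAvg M ψ) := by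
  have hc : Continuous fun φ => (Real.sqrt (κ / (1 + κ)) : ℂ) *
      Complex.exp (Complex.I * (φ₀ : ℂ)) * steeringSum M ψ φ :=
    (continuous_steeringSum M ψ).const_mul _
  have hLp : MemLp (fun φ => (Real.sqrt (κ / (1 + κ)) : ℂ) *
      Complex.exp (Complex.I * (φ₀ : ℂ)) * steeringSum M ψ φ) 2
      (cond (volume : Measure ℝ) (Set.Icc 0 (2 * Real.pi))) := by
    refine MemLp.of_bound hc.aestronglyMeasurable (Real.sqrt (κ / (1 + κ)) * M)
      (Filter.Eventually.of_forall fun φ => ?_)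
    rw [norm_mul, norm_mul, norm_exp_I_mul_ofReal, mul_one, Complex.norm_real, Real.norm_eq_abs,
      abs_of_nonneg (Real.sqrt_nonneg _)]
    gcongr
    refine (norm_sum_le _ _).trans ?_
    simp only [norm_exp_I_mul_ofReal]
    simp
  obtain ⟨hint, heq⟩ := integrable_and_integral_sq_norm_add hR
    (fun j => (Real.sqrt (1 / (1 + κ)) : ℂ) * w j) hLp
  simp only [rfEnergy, hH, jointLaw]
  refine ⟨hint.const_mul _, ?_⟩
  rw [integral_const_mul, heq]
  have h1 : ∀ φ, ‖(Real.sqrt (κ / (1 + κ)) : ℂ) * Complex.exp (Complex.I * (φ₀ : ℂ)) *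
      steeringSum M ψ φ‖ ^ 2 = κ / (1 + κ) * fAt M ψ φ := by
    intro φ
    rw [norm_mul, norm_mul, norm_exp_I_mul_ofReal, mul_one, Complex.norm_real, Real.norm_eq_abs,
      abs_of_nonneg (Real.sqrt_nonneg _), mul_pow, Real.sq_sqrt (by positivity),
      sq_norm_steeringSum hM h0]
  have h2 : ∑ i, ∑ j, ((((Real.sqrt (1 / (1 + κ)) : ℂ) * w i).re *
      ((Real.sqrt (1 / (1 + κ)) : ℂ) * w j).re + ((Real.sqrt (1 / (1 + κ)) : ℂ) * w i).im *
      ((Real.sqrt (1 / (1 + κ)) : ℂ) * w j).im) * R i j) =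
      1 / (1 + κ) * ∑ i, ∑ j, ((w i).re * (w j).re + (w i).im * (w j).im) * R i j := by
    simp_rw [Finset.mul_sum]
    refine Finset.sum_congr rfl fun i _ => Finset.sum_congr rfl fun j _ => ?_
    have hs : Real.sqrt (1 / (1 + κ)) ^ 2 = 1 / (1 + κ) := Real.sq_sqrt (by positivity)
    simp only [Complex.re_ofReal_mul, Complex.im_ofReal_mul]
    linear_combination (((w i).re * (w j).re + (w i).im * (w j).im) * R i j) * hs
  simp_rw [h1]
  rw [h2, integral_const_mul, integral_cond_Icc_two_pi, ← fAvg]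
  have hM' : (M : ℝ) ≠ 0 := by positivity
  field_simp
  ring

lemma sum_equivChannel (κ φ₀ : ℝ) (ψ : ℕ → ℝ) (φ : ℝ) (z : Fin M → ℂ) :
    ∑ j, equivChannel κ φ₀ ψ φ z j =
      (Real.sqrt (κ / (1 + κ)) : ℂ) * Complex.exp (Complex.I * (φ₀ : ℂ)) * steeringSum M ψ φ
        + ∑ j, ((Real.sqrt (1 / (1 + κ)) : ℂ) * 1) * z j := by
  simp only [equivChannel, steeringSum, Finset.sum_add_distrib, Finset.mul_sum, mul_one]

lemma sum_applyPsi_channel (κ φ₀ : ℝ) (ψ : ℕ → ℝ) (φ : ℝ) (z : Fin M → ℂ) :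
    ∑ j, applyPsi ψ (channel κ φ₀ φ z) j =
      (Real.sqrt (κ / (1 + κ)) : ℂ) * Complex.exp (Complex.I * (φ₀ : ℂ)) * steeringSum M ψ φ
        + ∑ j : Fin M, ((Real.sqrt (1 / (1 + κ)) : ℂ) *
          Complex.exp (Complex.I * (ψ (j : ℕ) : ℂ))) * z j := by
  simp only [applyPsi, channel, steeringSum, Finset.mul_sum]
  rw [← Finset.sum_add_distrib]
  refine Finset.sum_congr rfl fun j _ => ?_
  rw [Complex.ofReal_add, mul_add Complex.I, Complex.exp_add]
  ring

lemma integrable_and_avgRFEnergy_eq (hM : 1 ≤ M) (β : ℝ) {κ : ℝ} (φ₀ : ℝ) (hκ : 0 ≤ κ)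
    {R : Matrix (Fin M) (Fin M) ℝ} (hR : R.PosSemidef) {ψ : ℕ → ℝ} (h0 : ψ 0 = 0) :
    Integrable (fun p : ℝ × (Fin M → ℂ) => rfEnergy β (equivChannel κ φ₀ ψ p.1 p.2))
        (jointLaw R) ∧
      avgRFEnergy β κ φ₀ R ψ =
        β / ((M : ℝ) * (κ + 1)) * ((∑ i, ∑ j, R i j) + κ * fAvg M ψ) := by
  simpa [avgRFEnergy] using integrable_and_integral_rician hM β φ₀ hκ hR h0 (fun _ => 1)
    (fun p => sum_equivChannel κ φ₀ ψ p.1 p.2)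

/-- Now the scattering weights are `exp (I * ψ j)` instead of `1`. Having modulus one, they leave
the diagonal of `R` unchanged, and only the diagonal is nonzero. -/
lemma integral_rfEnergy_applyPsi (hM : 1 ≤ M) (β : ℝ) {κ : ℝ} (φ₀ : ℝ) (hκ : 0 ≤ κ)
    {R : Matrix (Fin M) (Fin M) ℝ} (hR : R.PosSemidef) (hdiag : R.IsDiag) {ψ : ℕ → ℝ}
    (h0 : ψ 0 = 0) :
    ∫ p, rfEnergy β (applyPsi ψ (channel κ φ₀ p.1 p.2)) ∂(jointLaw R) =
      avgRFEnergy β κ φ₀ R ψ := by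
  rw [(integrable_and_avgRFEnergy_eq hM β φ₀ hκ hR h0).2,
    (integrable_and_integral_rician hM β φ₀ hκ hR h0
      (fun j : Fin M => Complex.exp (Complex.I * (ψ (j : ℕ) : ℂ)))
      (fun p => sum_applyPsi_channel κ φ₀ ψ p.1 p.2)).2]
  congr 2
  refine Finset.sum_congr rfl fun i _ => Finset.sum_congr rfl fun j _ => ?_
  by_cases hij : i = j
  · subst hij
    have h := norm_exp_I_mul_ofReal (ψ i)
    have h' : ‖Complex.exp (Complex.I * (ψ i : ℂ))‖ ^ 2 = 1 := by rw [h]; norm_num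
    rw [Complex.sq_norm, Complex.normSq_apply] at h'
    rw [h', one_mul]
  · rw [hdiag hij, mul_zero]

lemma avgRFEnergy_le_avgRFEnergy (hM : 1 ≤ M) {β κ : ℝ} (φ₀ : ℝ) (hβ : 0 < β) (hκ : 0 ≤ κ)
    {R : Matrix (Fin M) (Fin M) ℝ} (hR : R.PosSemidef) {ψ ψ' : ℕ → ℝ} (h0 : ψ 0 = 0)
    (h0' : ψ' 0 = 0) (h : fAvg M ψ ≤ fAvg M ψ') :
    avgRFEnergy β κ φ₀ R ψ ≤ avgRFEnergy β κ φ₀ R ψ' := by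
  rw [(integrable_and_avgRFEnergy_eq hM β φ₀ hκ hR h0).2,
    (integrable_and_avgRFEnergy_eq hM β φ₀ hκ hR h0').2]
  gcongr

lemma avgRFEnergy_le_avgRFEnergy_iff (hM : 1 ≤ M) {β κ : ℝ} (φ₀ : ℝ) (hβ : 0 < β) (hκ : 0 < κ)
    {R : Matrix (Fin M) (Fin M) ℝ} (hR : R.PosSemidef) {ψ ψ' : ℕ → ℝ} (h0 : ψ 0 = 0)
    (h0' : ψ' 0 = 0) :
    avgRFEnergy β κ φ₀ R ψ ≤ avgRFEnergy β κ φ₀ R ψ' ↔ fAvg M ψ ≤ fAvg M ψ' := by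
  have hM' : (0 : ℝ) < M := by exact_mod_cast hM
  rw [(integrable_and_avgRFEnergy_eq hM β φ₀ hκ.le hR h0).2,
    (integrable_and_avgRFEnergy_eq hM β φ₀ hκ.le hR h0').2,
    mul_le_mul_iff_of_pos_left (by positivity), add_le_add_iff_left,
    mul_le_mul_iff_of_pos_left hκ]

end AASS

end

theorem mainTheorem3 (M : ℕ) (hM : 1 ≤ M) :
    -- closed form of the average over the azimuth
    (∀ ψ : ℕ → ℝ, AASS.fAvg M ψ =
      (M : ℝ) + 2 * ∑ t ∈ Finset.Icc 1 (M - 1), AASS.J0 ((t : ℝ) * Real.pi) * Real.cos (ψ t)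
        + 2 * ∑ t ∈ Finset.Icc 1 (M - 2), ∑ l ∈ Finset.Icc (t + 1) (M - 1),
            AASS.J0 (((t : ℝ) - (l : ℝ)) * Real.pi) * Real.cos (ψ t - ψ l)) ∧
    -- upper bound, attained by the alternating phases, which are a maximizer
    (∀ ψ : ℕ → ℝ, AASS.fAvg M ψ ≤ AASS.fUpper M) ∧
    AASS.fAvg M AASS.psiOpt = AASS.fUpper M ∧
    AASS.psiOpt ∈ AASS.admissible M ∧
    IsMaxOn (AASS.fAvg M) (AASS.admissible M) AASS.psiOpt ∧
    -- the maximizers are exactly the phase vectors with a shift of `π` between neighbours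
    (∀ ψ ∈ AASS.admissible M,
      IsMaxOn (AASS.fAvg M) (AASS.admissible M) ψ ↔ AASS.ConsecutivePiShifted M ψ) ∧
    -- average incident RF energy
    (∀ (β κ φ₀ : ℝ) (R : Matrix (Fin M) (Fin M) ℝ), 0 < β → 0 ≤ κ → R.PosSemidef →
      (∀ ψ ∈ AASS.admissible M,
        MeasureTheory.Integrable
          (fun p : ℝ × (Fin M → ℂ) => AASS.rfEnergy β (AASS.equivChannel κ φ₀ ψ p.1 p.2))
          (AASS.jointLaw R) ∧
        AASS.avgRFEnergy β κ φ₀ R ψ =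
          β / ((M : ℝ) * (κ + 1)) * ((∑ i, ∑ j, R i j) + κ * AASS.fAvg M ψ)) ∧
      IsMaxOn (AASS.avgRFEnergy β κ φ₀ R) (AASS.admissible M) AASS.psiOpt ∧
      (0 < κ → ∀ ψ ∈ AASS.admissible M,
        (IsMaxOn (AASS.avgRFEnergy β κ φ₀ R) (AASS.admissible M) ψ ↔
          AASS.ConsecutivePiShifted M ψ)) ∧
      -- for uncorrelated scattering, the equivalent channel gives the energy of `Ψ h` itself
      (R.IsDiag → ∀ ψ ∈ AASS.admissible M,
        ∫ p, AASS.rfEnergy β (AASS.applyPsi ψ (AASS.channel κ φ₀ p.1 p.2)) ∂(AASS.jointLaw R) =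
          AASS.avgRFEnergy β κ φ₀ R ψ)) := by
  refine ⟨AASS.fAvg_eq hM, AASS.fAvg_le_fUpper hM, AASS.fAvg_psiOpt hM,
    AASS.psiOpt_mem_admissible M, AASS.isMaxOn_fAvg_psiOpt hM,
    fun ψ hψ => AASS.isMaxOn_fAvg_iff hM hψ, fun β κ φ₀ R hβ hκ hR => ⟨?_, ?_, ?_, ?_⟩⟩
  · exact fun ψ hψ => AASS.integrable_and_avgRFEnergy_eq hM β φ₀ hκ hR hψ.1
  · exact fun ψ hψ => AASS.avgRFEnergy_le_avgRFEnergy hM φ₀ hβ hκ hR hψ.1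
      (AASS.psiOpt_mem_admissible M).1 (AASS.isMaxOn_fAvg_psiOpt hM hψ)
  · intro hκ' ψ hψ
    rw [← AASS.isMaxOn_fAvg_iff hM hψ]
    -- Both maximality statements unfold to a comparison with every admissible `ψ'`, and the two
    -- comparisons are equivalent because `κ > 0`.
    exact forall₂_congr fun ψ' hψ' =>
      AASS.avgRFEnergy_le_avgRFEnergy_iff hM φ₀ hβ hκ' hR hψ'.1 hψ.1
  · exact fun hdiag ψ hψ => AASS.integral_rfEnergy_applyPsi hM β φ₀ hκ hR hdiag hψ.1
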